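/- Let $\mathrm{HTop}$ be the homotopy category of topological spaces and $\mathrm{HPol}$ its full subcategory of spaces having the homotopy type of a polyhedron (the realization, with the weak topology, of a simplicial complex). An $\mathrm{HPol}$-expansion $\mathbf p=(p_\lambda)\colon X\to\mathbf X=(X_\lambda,p_{\lambda\lambda'},\Lambda)$ of a space $X$ is an inverse system $\mathbf X$ in $\mathrm{HPol}$ over a directed set $\Lambda$ together with morphisms $p_\lambda\colon X\to X_\lambda$ of $\mathrm{HTop}$ satisfying $p_{\lambda\lambda'}p_{\lambda'}=p_\lambda$ for $\lambda\le\lambda'$, such that for every $P\in\mathrm{HPol}$: (E1) every $h\colon X\to P$ in $\mathrm{HTop}$ equals $f p_\lambda$ for some $\lambda\in\Lambda$ and $f\colon X_\lambda\to P$; (E2) if $f_0,f_1\colon X_\lambda\to P$ satisfy $f_0p_\lambda=f_1p_\lambda$, then $f_0p_{\lambda\lambda'}=f_1p_{\lambda\lambda'}$ for some $\lambda'\ge\lambda$. An $S^*$-morphism $(f,f^n_\mu)\colon\mathbf X\to\mathbf Y=(Y_\mu,q_{\mu\mu'},M)$ of inverse systems consists of a function $f\colon M\to\Lambda$ and morphisms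 $f^n_\mu\colon X_{f(\mu)}\to Y_\mu$ ($n\in\mathbb N$, $\mu\in M$) such that for all $\mu\le\mu'$ there are $\lambda\ge f(\mu),f(\mu')$ and $n$ with $q_{\mu\mu'}f^{n'}_{\mu'}p_{f(\mu')\lambda}=f^{n'}_\mu p_{f(\mu)\lambda}$ for all $n'\ge n$. Two $S^*$-morphisms $(f,f^n_\mu),(f',f'^n_\mu)\colon\mathbf X\to\mathbf Y$ are equivalent if for every $\mu$ there are $\lambda\ge f(\mu),f'(\mu)$ and $n$ with $f^{n'}_\mu p_{f(\mu)\lambda}=f'^{n'}_\mu p_{f'(\mu)\lambda}$ for all $n'\ge n$. The equivalence classes are the morphisms of the category $\mathrm{pro}^*\text{-}\mathrm{HPol}$; the composite of $(f,f^n_\mu)\colon\mathbf X\to\mathbf Y$ and $(g,g^n_\nu)\colon\mathbf Y\to\mathbf Z$ is $(fg,\,g^n_\nu f^n_{g(\nu)})$, and a morphism $[(f,f_\mu)]$ of $\mathrm{pro}\text{-}\mathrm{HPol}$ is regarded as the morphism $[(f,f^n_\mu=f_\mu)]$. For spaces $Y$ and $X$, a coarse shape morphism $F^*\colon Y\to X$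 is the class of a morphism $\mathbf Y\to\mathbf X$ of $\mathrm{pro}^*\text{-}\mathrm{HPol}$ between $\mathrm{HPol}$-expansions of $Y$ and of $X$, where morphisms between different choices of expansions are identified when they correspond under the canonical isomorphisms of expansions (the unique isomorphisms $\mathbf i$ of $\mathrm{pro}\text{-}\mathrm{HPol}$ with $\mathbf i\mathbf p=\mathbf p'$). They form the set $Sh^*(Y,X)$ and are composed through representatives. A morphism $h\colon X\to X'$ of $\mathrm{HTop}$ induces a coarse shape morphism, the class of the unique $\mathbf h\colon\mathbf X\to\mathbf X'$ in $\mathrm{pro}\text{-}\mathrm{HPol}$ with $\mathbf h\mathbf p=\mathbf p'h$; it is again denoted by $h$. **Proposition.** Let $X$ and $Y$ be topological spaces. For an $\mathrm{HPol}$-expansion $\mathbf p\colon X\to(X_\lambda,p_{\lambda\lambda'},\Lambda)$ of $X$, $\lambda\in\Lambda$ and $F^*\in Sh^*(Y,X)$ put $$V^{F^*}_\lambda=\{G^*\in Sh^*(Y,X)\mid p_\lambda\circ F^*=p_\lambda\circ G^*\}.$$ 1. For every $\mathrm{HPol}$-expansion $\mathbf p$ of $X$, the family $\{V^{F^*}_\lambda\mid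 F^*\in Sh^*(Y,X),\ \lambda\in\Lambda\}$ is a basis for a topology $T_{\mathbf p}$ on $Sh^*(Y,X)$. 2. If $\mathbf p$ and $\mathbf p'$ are two $\mathrm{HPol}$-expansions of $X$, the identity map $(Sh^*(Y,X),T_{\mathbf p})\to(Sh^*(Y,X),T_{\mathbf p'})$ is a homeomorphism; so the topology depends only on $X$ and $Y$. 3. If $X$ is an object of $\mathrm{HPol}$ (in particular, if $X$ is a polyhedron), then $Sh^*(Y,X)$ with this topology is discrete. -/

import Mathlib

open CategoryTheory

universe w v u

noncomputable section

namespace CoarseShape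

/-! ## Inverse systems -/

/-- An inverse system `(X_a, p_{ab}, Λ)` in a category, indexed by a (nonempty) directed
preordered set `Λ`; the bonding morphism `p_{ab} : X_b ⟶ X_a` is `map` at `a ≤ b`. -/
structure InverseSystem (C : Type u) [Category.{v} C] where
  Idx : Type w
  [preorder : Preorder Idx]
  [directed : IsDirectedOrder Idx]
  [nonempty : Nonempty Idx]
  obj : Idx → C
  map : ∀ {a b : Idx}, a ≤ b → (obj b ⟶ obj a)
  map_refl : ∀ a : Idx, map (le_refl a) = 𝟙 (obj a)
  map_map : ∀ {a b c : Idx} (h : a ≤ b) (h' : b ≤ c), map h' ≫ map h = map (h.trans h')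

attribute [instance] InverseSystem.preorder InverseSystem.directed InverseSystem.nonempty

variable {C : Type u} [Category.{v} C]

namespace InverseSystem

theorem eq_of_le (X : InverseSystem.{w} C) {a b c d : X.Idx} (ha : a ≤ c) (hb : b ≤ c)
    (hcd : c ≤ d) {Q : C} {f : X.obj a ⟶ Q} {g : X.obj b ⟶ Q}
    (e : X.map ha ≫ f = X.map hb ≫ g) :
    X.map (ha.trans hcd) ≫ f = X.map (hb.trans hcd) ≫ g := by
  rw [← X.map_map ha hcd, ← X.map_map hb hcd, Category.assoc, Category.assoc, e]

/-- The rudimentary inverse system `(X)`, indexed by a singleton. -/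
abbrev rudimentary (X : C) : InverseSystem.{w} C where
  Idx := PUnit
  obj _ := X
  map _ := 𝟙 X
  map_refl _ := rfl
  map_map _ _ := Category.comp_id _

end InverseSystem

/-! ## The category `pro-C` -/

/-- A morphism of inverse systems `(f, f_μ) : X → Y`: an index function and morphisms
`f_μ : X_{f(μ)} → Y_μ` such that for `μ ≤ μ'` one has
`q_{μμ'} f_{μ'} p_{f(μ')a} = f_μ p_{f(μ)a}` for some `a ≥ f(μ), f(μ')`. -/
structure SysMor (X Y : InverseSystem.{w} C) where
  idx : Y.Idx → X.Idx
  app : ∀ m : Y.Idx, X.obj (idx m) ⟶ Y.obj m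
  comm : ∀ {m m' : Y.Idx} (h : m ≤ m'), ∃ (a : X.Idx) (h₁ : idx m ≤ a) (h₂ : idx m' ≤ a),
    X.map h₂ ≫ app m' ≫ Y.map h = X.map h₁ ≫ app m

namespace SysMor

/-- Equivalence of morphisms of inverse systems. -/
def Equiv {X Y : InverseSystem.{w} C} (f f' : SysMor X Y) : Prop :=
  ∀ m : Y.Idx, ∃ (a : X.Idx) (h₁ : f.idx m ≤ a) (h₂ : f'.idx m ≤ a),
    X.map h₁ ≫ f.app m = X.map h₂ ≫ f'.app m

theorem equiv_equivalence (X Y : InverseSystem.{w} C) :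
    Equivalence (Equiv (X := X) (Y := Y)) where
  refl f m := ⟨f.idx m, le_refl _, le_refl _, rfl⟩
  symm h m := by
    obtain ⟨a, h₁, h₂, e⟩ := h m
    exact ⟨a, h₂, h₁, e.symm⟩
  trans h h' m := by
    obtain ⟨a, h₁, h₂, e⟩ := h m
    obtain ⟨b, k₁, k₂, e'⟩ := h' m
    obtain ⟨c, hac, hbc⟩ := exists_ge_ge a b
    exact ⟨c, h₁.trans hac, k₂.trans hbc,
      (X.eq_of_le h₁ h₂ hac e).trans (X.eq_of_le k₁ k₂ hbc e')⟩

instance setoid (X Y : InverseSystem.{w} C) : Setoid (SysMor X Y) :=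
  ⟨Equiv, equiv_equivalence X Y⟩

/-- The identity `(1, 1_{X_a})`. -/
def id (X : InverseSystem.{w} C) : SysMor X X where
  idx a := a
  app a := 𝟙 (X.obj a)
  comm {m m'} h := ⟨m', h, le_refl _, by simp [X.map_refl]⟩

/-- The composite `(g, g_ν)(f, f_μ) = (fg, g_ν f_{g(ν)})`. -/
def comp {X Y Z : InverseSystem.{w} C} (f : SysMor X Y) (g : SysMor Y Z) : SysMor X Z where
  idx n := f.idx (g.idx n)
  app n := f.app (g.idx n) ≫ g.app n
  comm {n n'} h := by
    obtain ⟨b, h₁, h₂, e⟩ := g.comm h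
    obtain ⟨a₁, i₁, j₁, e₁⟩ := f.comm h₁
    obtain ⟨a₂, i₂, j₂, e₂⟩ := f.comm h₂
    obtain ⟨a, k₁, k₂⟩ := exists_ge_ge a₁ a₂
    refine ⟨a, i₁.trans k₁, i₂.trans k₂, ?_⟩
    have e₁' := X.eq_of_le j₁ i₁ k₁ e₁
    have e₂' := X.eq_of_le j₂ i₂ k₂ e₂
    have hj : X.map (j₁.trans k₁) = X.map (j₂.trans k₂) := rfl
    simp only [Category.assoc]
    rw [← Category.assoc _ (f.app _), ← e₂', ← Category.assoc _ (f.app (g.idx n)), ← e₁', ← hj]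
    simp only [Category.assoc]
    rw [e]

theorem comp_congr {X Y Z : InverseSystem.{w} C} {f f' : SysMor X Y} {g g' : SysMor Y Z}
    (hf : Equiv f f') (hg : Equiv g g') : Equiv (f.comp g) (f'.comp g') := by
  intro n
  obtain ⟨b, h₁, h₂, e⟩ := hg n
  obtain ⟨a₁, i₁, j₁, e₁⟩ := f.comm h₁
  obtain ⟨a₂, i₂, j₂, e₂⟩ := f.comm h₂
  obtain ⟨a₃, i₃, j₃, e₃⟩ := hf (g'.idx n)
  obtain ⟨a', k₁, k₂⟩ := exists_ge_ge a₁ a₂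
  obtain ⟨a, l, k₃⟩ := exists_ge_ge a' a₃
  refine ⟨a, i₁.trans (k₁.trans l), j₃.trans k₃, ?_⟩
  have e₁' := X.eq_of_le j₁ i₁ (k₁.trans l) e₁
  have e₂' := X.eq_of_le j₂ i₂ (k₂.trans l) e₂
  have e₃' := X.eq_of_le i₃ j₃ k₃ e₃
  have hi : X.map (i₃.trans k₃) = X.map (i₂.trans (k₂.trans l)) := rfl
  have hj : X.map (j₁.trans (k₁.trans l)) = X.map (j₂.trans (k₂.trans l)) := rfl
  simp only [comp]
  rw [← Category.assoc _ (f.app _), ← e₁', ← Category.assoc _ (f'.app _), ← e₃', hi, ← e₂', ← hj]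
  simp only [Category.assoc]
  rw [e]

end SysMor

variable (C) in
/-- Objects of `pro-C`: inverse systems in `C`. -/
structure Pro where
  sys : InverseSystem.{w} C

/-- `pro-C`: morphisms are equivalence classes of morphisms of inverse systems. -/
instance : Category (Pro.{w} C) where
  Hom X Y := Quotient (SysMor.setoid X.sys Y.sys)
  id X := Quotient.mk _ (SysMor.id X.sys)
  comp f g := Quotient.map₂ SysMor.comp
    (fun _ _ hf _ _ hg => SysMor.comp_congr hf hg) f g
  id_comp := by
    rintro X Y ⟨f⟩
    exact Quotient.sound fun m => ⟨f.idx m, le_refl _, le_refl _, by simp [SysMor.comp, SysMor.id]⟩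
  comp_id := by
    rintro X Y ⟨f⟩
    exact Quotient.sound fun m => ⟨f.idx m, le_refl _, le_refl _, by simp [SysMor.comp, SysMor.id]⟩
  assoc := by
    rintro X Y Z W ⟨f⟩ ⟨g⟩ ⟨h⟩
    exact Quotient.sound fun m => ⟨_, le_refl _, le_refl _, by simp [SysMor.comp]⟩

/-- The class in `pro-C` of a morphism of inverse systems. -/
def Pro.ofMor {X Y : Pro.{w} C} (f : SysMor X.sys Y.sys) : X ⟶ Y := Quotient.mk _ f

/-! ## The category `pro*-C` -/

/-- An `S*`-morphism `(f, f^n_μ) : X → Y`: an index function and morphisms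
`f^n_μ : X_{f(μ)} → Y_μ` such that for `μ ≤ μ'` there are `a ≥ f(μ), f(μ')` and `n` with
`q_{μμ'} f^{n'}_{μ'} p_{f(μ')a} = f^{n'}_μ p_{f(μ)a}` for all `n' ≥ n`. -/
structure SStarMor (X Y : InverseSystem.{w} C) where
  idx : Y.Idx → X.Idx
  app : ℕ → ∀ m : Y.Idx, X.obj (idx m) ⟶ Y.obj m
  comm : ∀ {m m' : Y.Idx} (h : m ≤ m'), ∃ (a : X.Idx) (h₁ : idx m ≤ a) (h₂ : idx m' ≤ a) (n : ℕ),
    ∀ n' ≥ n, X.map h₂ ≫ app n' m' ≫ Y.map h = X.map h₁ ≫ app n' m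

namespace SStarMor

/-- Equivalence of `S*`-morphisms. -/
def Equiv {X Y : InverseSystem.{w} C} (f f' : SStarMor X Y) : Prop :=
  ∀ m : Y.Idx, ∃ (a : X.Idx) (h₁ : f.idx m ≤ a) (h₂ : f'.idx m ≤ a) (n : ℕ),
    ∀ n' ≥ n, X.map h₁ ≫ f.app n' m = X.map h₂ ≫ f'.app n' m

theorem equiv_equivalence (X Y : InverseSystem.{w} C) :
    Equivalence (Equiv (X := X) (Y := Y)) where
  refl f m := ⟨f.idx m, le_refl _, le_refl _, 0, fun _ _ => rfl⟩
  symm h m := by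
    obtain ⟨a, h₁, h₂, n, e⟩ := h m
    exact ⟨a, h₂, h₁, n, fun n' hn => (e n' hn).symm⟩
  trans h h' m := by
    obtain ⟨a, h₁, h₂, n, e⟩ := h m
    obtain ⟨b, k₁, k₂, k, e'⟩ := h' m
    obtain ⟨c, hac, hbc⟩ := exists_ge_ge a b
    exact ⟨c, h₁.trans hac, k₂.trans hbc, max n k, fun n' hn =>
      (X.eq_of_le h₁ h₂ hac (e n' (le_of_max_le_left hn))).trans
        (X.eq_of_le k₁ k₂ hbc (e' n' (le_of_max_le_right hn)))⟩

instance setoid (X Y : InverseSystem.{w} C) : Setoid (SStarMor X Y) :=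
  ⟨Equiv, equiv_equivalence X Y⟩

/-- The `S*`-morphism with `f^n_μ = f_μ` for all `n`. -/
def const {X Y : InverseSystem.{w} C} (f : SysMor X Y) : SStarMor X Y where
  idx := f.idx
  app _ := f.app
  comm h := by
    obtain ⟨a, h₁, h₂, e⟩ := f.comm h
    exact ⟨a, h₁, h₂, 0, fun _ _ => e⟩

/-- The identity `(1, 1^n_{X_a})`. -/
def id (X : InverseSystem.{w} C) : SStarMor X X where
  idx a := a
  app _ a := 𝟙 (X.obj a)
  comm {m m'} h := ⟨m', h, le_refl _, 0, fun _ _ => by simp [X.map_refl]⟩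

/-- The composite `(g, g^n_ν)(f, f^n_μ) = (fg, g^n_ν f^n_{g(ν)})`. -/
def comp {X Y Z : InverseSystem.{w} C} (f : SStarMor X Y) (g : SStarMor Y Z) :
    SStarMor X Z where
  idx n := f.idx (g.idx n)
  app k n := f.app k (g.idx n) ≫ g.app k n
  comm {n n'} h := by
    obtain ⟨b, h₁, h₂, k₀, e⟩ := g.comm h
    obtain ⟨a₁, i₁, j₁, k₁, e₁⟩ := f.comm h₁
    obtain ⟨a₂, i₂, j₂, k₂, e₂⟩ := f.comm h₂
    obtain ⟨a, l₁, l₂⟩ := exists_ge_ge a₁ a₂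
    refine ⟨a, i₁.trans l₁, i₂.trans l₂, max k₀ (max k₁ k₂), fun k hk => ?_⟩
    have e := e k (by omega)
    have e₁' := X.eq_of_le j₁ i₁ l₁ (e₁ k (by omega))
    have e₂' := X.eq_of_le j₂ i₂ l₂ (e₂ k (by omega))
    have hj : X.map (j₁.trans l₁) = X.map (j₂.trans l₂) := rfl
    simp only [Category.assoc]
    rw [← Category.assoc _ (f.app _ _), ← e₂', ← Category.assoc _ (f.app _ (g.idx n)), ← e₁', ← hj]
    simp only [Category.assoc]
    rw [e]

theorem comp_congr {X Y Z : InverseSystem.{w} C} {f f' : SStarMor X Y} {g g' : SStarMor Y Z}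
    (hf : Equiv f f') (hg : Equiv g g') : Equiv (f.comp g) (f'.comp g') := by
  intro n
  obtain ⟨b, h₁, h₂, r₀, e⟩ := hg n
  obtain ⟨a₁, i₁, j₁, r₁, e₁⟩ := f.comm h₁
  obtain ⟨a₂, i₂, j₂, r₂, e₂⟩ := f.comm h₂
  obtain ⟨a₃, i₃, j₃, r₃, e₃⟩ := hf (g'.idx n)
  obtain ⟨a', k₁, k₂⟩ := exists_ge_ge a₁ a₂
  obtain ⟨a, l, k₃⟩ := exists_ge_ge a' a₃
  refine ⟨a, i₁.trans (k₁.trans l), j₃.trans k₃, max (max r₀ r₁) (max r₂ r₃), fun k hk => ?_⟩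
  have e := e k (by omega)
  have e₁' := X.eq_of_le j₁ i₁ (k₁.trans l) (e₁ k (by omega))
  have e₂' := X.eq_of_le j₂ i₂ (k₂.trans l) (e₂ k (by omega))
  have e₃' := X.eq_of_le i₃ j₃ k₃ (e₃ k (by omega))
  have hi : X.map (i₃.trans k₃) = X.map (i₂.trans (k₂.trans l)) := rfl
  have hj : X.map (j₁.trans (k₁.trans l)) = X.map (j₂.trans (k₂.trans l)) := rfl
  simp only [comp]
  rw [← Category.assoc _ (f.app _ _), ← e₁', ← Category.assoc _ (f'.app _ _), ← e₃', hi, ← e₂',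
    ← hj]
  simp only [Category.assoc]
  rw [e]

end SStarMor

variable (C) in
/-- Objects of `pro*-C`: inverse systems in `C`. -/
structure ProStar where
  sys : InverseSystem.{w} C

/-- `pro*-C`: morphisms are equivalence classes of `S*`-morphisms. -/
instance : Category (ProStar.{w} C) where
  Hom X Y := Quotient (SStarMor.setoid X.sys Y.sys)
  id X := Quotient.mk _ (SStarMor.id X.sys)
  comp f g := Quotient.map₂ SStarMor.comp
    (fun _ _ hf _ _ hg => SStarMor.comp_congr hf hg) f g
  id_comp := by
    rintro X Y ⟨f⟩
    exact Quotient.sound fun m =>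
      ⟨f.idx m, le_refl _, le_refl _, 0, by simp [SStarMor.comp, SStarMor.id]⟩
  comp_id := by
    rintro X Y ⟨f⟩
    exact Quotient.sound fun m =>
      ⟨f.idx m, le_refl _, le_refl _, 0, by simp [SStarMor.comp, SStarMor.id]⟩
  assoc := by
    rintro X Y Z W ⟨f⟩ ⟨g⟩ ⟨h⟩
    exact Quotient.sound fun m => ⟨_, le_refl _, le_refl _, 0, by simp [SStarMor.comp]⟩

/-- The class in `pro*-C` of an `S*`-morphism. -/
def ProStar.ofMor {X Y : ProStar.{w} C} (f : SStarMor X.sys Y.sys) : X ⟶ Y := Quotient.mk _ f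

variable (C) in
/-- The functor `pro-C ⥤ pro*-C`, the identity on objects and `[(f, f_μ)] ↦ [(f, f^n_μ = f_μ)]`. -/
def inclusion : Pro.{w} C ⥤ ProStar.{w} C where
  obj X := ⟨X.sys⟩
  map f := Quotient.map SStarMor.const
    (fun _ _ h m => by
      obtain ⟨a, h₁, h₂, e⟩ := h m
      exact ⟨a, h₁, h₂, 0, fun _ _ => e⟩) f
  map_id _ := rfl
  map_comp := by
    rintro X Y Z ⟨f⟩ ⟨g⟩
    rfl

/-! ## Expansions -/

/-- A `P`-expansion of `X`, where `P` is a full subcategory of `C`: an inverse system in `P` and a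
morphism from `X` to it in `pro-C`, i.e. a family `p_a : X ⟶ X_a` compatible with the bonding
morphisms: morphisms from `X` to objects of `P` factor through some `p_a` (`e1`), and two morphisms
from `X_a` that agree after `p_a` agree after some bonding morphism (`e2`). -/
structure Expansion (P : ObjectProperty C) (X : C) where
  sys : InverseSystem.{w} C
  mem : ∀ a, P (sys.obj a)
  proj : ∀ a, X ⟶ sys.obj a
  proj_map : ∀ {a b : sys.Idx} (h : a ≤ b), proj b ≫ sys.map h = proj a
  e1 : ∀ ⦃Q : C⦄, P Q → ∀ h : X ⟶ Q, ∃ (a : sys.Idx) (f : sys.obj a ⟶ Q), proj a ≫ f = h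
  e2 : ∀ ⦃Q : C⦄, P Q → ∀ (a : sys.Idx) (f₀ f₁ : sys.obj a ⟶ Q), proj a ≫ f₀ = proj a ≫ f₁ →
    ∃ (b : sys.Idx) (h : a ≤ b), sys.map h ≫ f₀ = sys.map h ≫ f₁

/-- A morphism of `C` as a morphism of rudimentary systems in `pro-C`. -/
def rudimentaryHom {X Y : C} (f : X ⟶ Y) :
    (⟨.rudimentary X⟩ : Pro.{w} C) ⟶ ⟨.rudimentary Y⟩ :=
  Pro.ofMor (X := ⟨.rudimentary X⟩) (Y := ⟨.rudimentary Y⟩)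
    { idx := fun m => m
      app := fun _ => f
      comm := fun {m _} _ =>
        ⟨m, le_refl _, le_refl _, by simp [InverseSystem.rudimentary]⟩ }

namespace Expansion

variable {P : ObjectProperty C} {X Y Z : C}

/-- The target of an expansion, in `pro-C`. -/
abbrev toPro (p : Expansion.{w} P X) : Pro.{w} C := ⟨p.sys⟩

/-- The target of an expansion, in `pro*-C`. -/
abbrev toProStar (p : Expansion.{w} P X) : ProStar.{w} C := (inclusion C).obj p.toPro

/-- The morphism `p : (X) ⟶ 𝐗` of `pro-C` which an expansion is. -/
def hom (p : Expansion.{w} P X) : (⟨.rudimentary X⟩ : Pro.{w} C) ⟶ p.toPro :=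
  Pro.ofMor (X := ⟨.rudimentary X⟩) (Y := p.toPro)
    { idx := fun _ => PUnit.unit
      app := p.proj
      comm := fun {m m'} h => ⟨PUnit.unit, le_refl _, le_refl _,
        show 𝟙 X ≫ p.proj m' ≫ p.sys.map h = 𝟙 X ≫ p.proj m by rw [p.proj_map h]⟩ }

/-- Every morphism of `pro-C` from `X` to a system in `P` factors uniquely through an expansion. -/
theorem existsUnique_lift (p : Expansion.{w} P X) (T : Pro.{w} C) (hT : ∀ m, P (T.sys.obj m))
    (g : (⟨.rudimentary X⟩ : Pro.{w} C) ⟶ T) :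
    ∃! f : p.toPro ⟶ T, p.hom ≫ f = g := by
  obtain ⟨g⟩ := g
  let g₀ : ∀ m : T.sys.Idx, X ⟶ T.sys.obj m := g.app
  choose i f hf using fun m => p.e1 (hT m) (g₀ m)
  have key : ∀ (m : T.sys.Idx) (a b : p.sys.Idx) (s : p.sys.obj a ⟶ T.sys.obj m)
      (t : p.sys.obj b ⟶ T.sys.obj m), p.proj a ≫ s = p.proj b ≫ t →
      ∃ (c : p.sys.Idx) (h₁ : a ≤ c) (h₂ : b ≤ c), p.sys.map h₁ ≫ s = p.sys.map h₂ ≫ t := by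
    intro m a b s t e
    obtain ⟨c, h₁, h₂⟩ := exists_ge_ge a b
    obtain ⟨d, h, e'⟩ := p.e2 (hT m) c (p.sys.map h₁ ≫ s) (p.sys.map h₂ ≫ t) (by
      rw [← Category.assoc, ← Category.assoc, p.proj_map, p.proj_map, e])
    rw [← Category.assoc, ← Category.assoc, p.sys.map_map, p.sys.map_map] at e'
    exact ⟨d, h₁.trans h, h₂.trans h, e'⟩
  have gcomm : ∀ {m m' : T.sys.Idx} (h : m ≤ m'), g₀ m' ≫ T.sys.map h = g₀ m := by
    intro m m' h
    obtain ⟨a, h₁, h₂, e⟩ := g.comm h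
    have e' : 𝟙 X ≫ g₀ m' ≫ T.sys.map h = 𝟙 X ≫ g₀ m := e
    rwa [Category.id_comp, Category.id_comp] at e'
  let F : SysMor p.sys T.sys :=
    { idx := i
      app := f
      comm := by
        intro m m' h
        obtain ⟨c, h₁, h₂, e⟩ := key m _ _ (f m' ≫ T.sys.map h) (f m) (by
          rw [← Category.assoc, hf, hf, gcomm])
        exact ⟨c, h₂, h₁, e⟩ }
  refine ⟨Quotient.mk _ F, ?_, ?_⟩
  · refine Quotient.sound fun m => ⟨PUnit.unit, le_refl _, le_refl _, ?_⟩
    change 𝟙 X ≫ p.proj (i m) ≫ f m = 𝟙 X ≫ g₀ m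
    rw [hf]
  · rintro ⟨f'⟩ hf'
    refine Quotient.sound fun m => ?_
    obtain ⟨a, h₁, h₂, e⟩ := Quotient.exact hf' m
    have e' : 𝟙 X ≫ p.proj (f'.idx m) ≫ f'.app m = 𝟙 X ≫ g₀ m := e
    refine key m (f'.idx m) (i m) (f'.app m) (f m) ?_
    rw [Category.id_comp, Category.id_comp] at e'
    rw [e', hf]

/-- For expansions `p` of `X` and `q` of `Y` and `f : X ⟶ Y`, the unique morphism `𝐟` of `pro-C`
with `𝐟 p = q f`. -/
def lift (p : Expansion.{w} P X) (q : Expansion.{w} P Y) (f : X ⟶ Y) : p.toPro ⟶ q.toPro :=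
  (p.existsUnique_lift q.toPro q.mem (rudimentaryHom f ≫ q.hom)).choose

theorem hom_lift (p : Expansion.{w} P X) (q : Expansion.{w} P Y) (f : X ⟶ Y) :
    p.hom ≫ p.lift q f = rudimentaryHom f ≫ q.hom :=
  (p.existsUnique_lift q.toPro q.mem (rudimentaryHom f ≫ q.hom)).choose_spec.1

/-- For two expansions `p, p'` of `X`, the unique (iso)morphism `i` of `pro-C` with `i p = p'`. -/
def can (p p' : Expansion.{w} P X) : p.toPro ⟶ p'.toPro :=
  (p.existsUnique_lift p'.toPro p'.mem p'.hom).choose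

theorem hom_can (p p' : Expansion.{w} P X) : p.hom ≫ p.can p' = p'.hom :=
  (p.existsUnique_lift p'.toPro p'.mem p'.hom).choose_spec.1

theorem can_unique (p p' : Expansion.{w} P X) (i : p.toPro ⟶ p'.toPro) (h : p.hom ≫ i = p'.hom) :
    i = p.can p' :=
  (p.existsUnique_lift p'.toPro p'.mem p'.hom).choose_spec.2 i h

theorem can_self (p : Expansion.{w} P X) : p.can p = 𝟙 _ :=
  (p.can_unique p _ (Category.comp_id _)).symm

theorem can_can (p p' p'' : Expansion.{w} P X) : p.can p' ≫ p'.can p'' = p.can p'' :=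
  p.can_unique p'' _ (by rw [← Category.assoc, hom_can, hom_can])

/-- The canonical isomorphism between two expansions of `X`, in `pro*-C`. -/
def canStar (p p' : Expansion.{w} P X) : p.toProStar ⟶ p'.toProStar :=
  (inclusion C).map (p.can p')

theorem canStar_self (p : Expansion.{w} P X) : p.canStar p = 𝟙 _ := by
  rw [canStar, can_self]
  exact (inclusion C).map_id _

theorem canStar_canStar (p p' p'' : Expansion.{w} P X) :
    p.canStar p' ≫ p'.canStar p'' = p.canStar p'' := by
  rw [canStar, canStar, canStar, ← can_can p p' p'']
  exact ((inclusion C).map_comp _ _).symm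

/-- The rudimentary expansion `1 : X ⟶ (X)` of an object of `P`. -/
def rudimentary (hX : P X) : Expansion.{w} P X where
  sys := .rudimentary X
  mem _ := hX
  proj _ := 𝟙 X
  proj_map _ := Category.comp_id _
  e1 _ _ h := ⟨PUnit.unit, h, Category.id_comp _⟩
  e2 _ _ a _ _ e := ⟨a, le_refl _, e⟩

end Expansion

/-! ## Coarse shape morphisms -/

/-- A representative of a coarse shape morphism `Y → X`: a morphism `𝐘 → 𝐗` of `pro*-P` between
(the targets of) `P`-expansions of `Y` and of `X`. -/
structure Rep (P : ObjectProperty C) (Y X : C) where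
  dom : Expansion.{w} P Y
  cod : Expansion.{w} P X
  hom : dom.toProStar ⟶ cod.toProStar

/-- `pro*-P` equivalence: the representatives agree up to the canonical isomorphisms. -/
instance Rep.setoid (P : ObjectProperty C) (Y X : C) : Setoid (Rep.{w} P Y X) where
  r f f' := f.dom.canStar f'.dom ≫ f'.hom = f.hom ≫ f.cod.canStar f'.cod
  iseqv :=
    { refl := fun f => by
        rw [Expansion.canStar_self, Expansion.canStar_self, Category.id_comp, Category.comp_id]
      symm := fun {f f'} h => by
        calc f'.dom.canStar f.dom ≫ f.hom
            = f'.dom.canStar f.dom ≫ (f.hom ≫ f.cod.canStar f'.cod) ≫ f'.cod.canStar f.cod := by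
              rw [Category.assoc, Expansion.canStar_canStar, Expansion.canStar_self,
                Category.comp_id]
          _ = f'.hom ≫ f'.cod.canStar f.cod := by
              rw [← h, ← Category.assoc, ← Category.assoc, Expansion.canStar_canStar,
                Expansion.canStar_self, Category.id_comp]
      trans := fun {f f' f''} h h' => by
        rw [← Expansion.canStar_canStar f.dom f'.dom f''.dom, Category.assoc, h',
          ← Category.assoc, h, Category.assoc, Expansion.canStar_canStar] }

/-- The set `Sh*(Y, X)` of coarse shape morphisms for the pair `(C, P)`. -/
def Hom (P : ObjectProperty C) (Y X : C) := Quotient (Rep.setoid.{w} P Y X)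

namespace Hom

variable {P : ObjectProperty C} {X Y Z : C}

/-- The composite `G* ∘ F*`, through representatives: `𝐟 : 𝐗 → 𝐘` and `𝐠 : 𝐘' → 𝐙` are composed
along the canonical isomorphism `𝐘 → 𝐘'`. -/
def comp (G : Hom.{w} P Y Z) (F : Hom.{w} P X Y) : Hom.{w} P X Z :=
  Quotient.map₂
    (fun g f : Rep.{w} P _ _ => (⟨f.dom, g.cod, f.hom ≫ f.cod.canStar g.dom ≫ g.hom⟩ : Rep P X Z))
    (by
      intro g g' hg f f' hf
      have hg : g.dom.canStar g'.dom ≫ g'.hom = g.hom ≫ g.cod.canStar g'.cod := hg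
      have hf : f.dom.canStar f'.dom ≫ f'.hom = f.hom ≫ f.cod.canStar f'.cod := hf
      change f.dom.canStar f'.dom ≫ f'.hom ≫ f'.cod.canStar g'.dom ≫ g'.hom =
        (f.hom ≫ f.cod.canStar g.dom ≫ g.hom) ≫ g.cod.canStar g'.cod
      rw [← Category.assoc, hf, Category.assoc, Category.assoc, Category.assoc, ← hg,
        ← Category.assoc (f.cod.canStar f'.cod), Expansion.canStar_canStar,
        ← Category.assoc (f.cod.canStar g.dom), Expansion.canStar_canStar]) G F

/-- The coarse shape morphism `S*(f)` of `f : X ⟶ Y`, computed with expansions `p` of `X` and `q`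
of `Y`. -/
def ofHom (p : Expansion.{w} P X) (q : Expansion.{w} P Y) (f : X ⟶ Y) : Hom.{w} P X Y :=
  Quotient.mk _ ⟨p, q, (inclusion C).map (p.lift q f)⟩

/-- `S*(f)` does not depend on the expansions. -/
theorem ofHom_eq (p p' : Expansion.{w} P X) (q q' : Expansion.{w} P Y) (f : X ⟶ Y) :
    ofHom p q f = ofHom p' q' f := by
  refine Quotient.sound ?_
  change (inclusion C).map (p.can p') ≫ (inclusion C).map (p'.lift q' f) =
    (inclusion C).map (p.lift q f) ≫ (inclusion C).map (q.can q')
  rw [← Functor.map_comp, ← Functor.map_comp]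
  congr 1
  refine (p.existsUnique_lift q'.toPro q'.mem (rudimentaryHom f ≫ q'.hom)).unique ?_ ?_
  · rw [← Category.assoc, Expansion.hom_can, Expansion.hom_lift]
  · rw [← Category.assoc, Expansion.hom_lift, Category.assoc, Expansion.hom_can]

end Hom

/-! ## The sets `V_a^F` and the topology `T_p` -/

namespace Expansion

variable {P : ObjectProperty C} {X : C}

/-- The projection `p_a : X → X_a` of an expansion as a coarse shape morphism `S*(p_a)`. -/
def projStar (p : Expansion.{w} P X) (a : p.sys.Idx) : Hom.{w} P X (p.sys.obj a) :=
  Hom.ofHom p (rudimentary (p.mem a)) (p.proj a)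

/-- `V_a^F = {G | p_a ∘ F = p_a ∘ G}`. -/
def basic (p : Expansion.{w} P X) (Y : C) (a : p.sys.Idx) (F : Hom.{w} P Y X) :
    Set (Hom.{w} P Y X) :=
  {G | (p.projStar a).comp F = (p.projStar a).comp G}

/-- The family of all `V_a^F`. -/
def basicFamily (p : Expansion.{w} P X) (Y : C) : Set (Set (Hom.{w} P Y X)) :=
  {V | ∃ (F : Hom.{w} P Y X) (a : p.sys.Idx), V = p.basic Y a F}

/-- The topology `T_p` generated by the sets `V_a^F`. -/
@[reducible] def topology (p : Expansion.{w} P X) (Y : C) : TopologicalSpace (Hom.{w} P Y X) :=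
  .generateFrom (p.basicFamily Y)

end Expansion

/-! ## The homotopy category and polyhedra -/

/-- The relation of homotopy between continuous maps. -/
def homotopyRel : HomRel TopCat.{u} := fun _ _ f g => f.hom.Homotopic g.hom

instance : Congruence homotopyRel.{u} where
  equivalence :=
    { refl := fun f => .refl f.hom
      symm := fun h => h.symm
      trans := fun h h' => h.trans h' }
  comp_left f _ _ h := ContinuousMap.Homotopic.comp h (.refl f.hom)
  comp_right g h := ContinuousMap.Homotopic.comp (.refl g.hom) h

/-- The homotopy category `HTop` of topological spaces. -/
abbrev HTop := CategoryTheory.Quotient homotopyRel.{u}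

/-- A topological space as an object of `HTop`. -/
def HTop.of (X : Type u) [TopologicalSpace X] : HTop.{u} := ⟨TopCat.of X⟩

/-- The geometric realization `|K|` of an abstract simplicial complex: finitely supported families
of barycentric coordinates whose support lies in a face. -/
def Realization {V : Type u} (K : AbstractSimplicialComplex V) : Type u :=
  {t : V → ℝ // ∃ s ∈ K, (∀ v, 0 ≤ t v) ∧ (∀ v, v ∉ s → t v = 0) ∧ ∑ v ∈ s, t v = 1}

open Classical in
/-- The closed simplex of `|K|` spanned by a face. -/
def Realization.face {V : Type u} (K : AbstractSimplicialComplex V) (s : Finset V) (hs : s ∈ K)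
    (x : stdSimplex ℝ s) : Realization K :=
  ⟨fun v => if h : v ∈ s then x.1 ⟨v, h⟩ else 0, s, hs,
    fun v => by
      dsimp only
      split_ifs with h
      · exact x.2.1 _
      · exact le_refl _,
    fun v h => dif_neg h,
    by
      rw [← Finset.sum_coe_sort s]
      simpa using x.2.2⟩

/-- The weak topology: a set is open if and only if its trace on each closed simplex is. -/
instance {V : Type u} (K : AbstractSimplicialComplex V) : TopologicalSpace (Realization K) :=
  ⨆ s : {s : Finset V // s ∈ K}, .coinduced (Realization.face K s.1 s.2) inferInstance

/-- A polyhedron: a space homeomorphic to the realization of a simplicial complex. -/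
def IsPolyhedron (X : Type u) [TopologicalSpace X] : Prop :=
  ∃ (V : Type u) (K : AbstractSimplicialComplex V), Nonempty (X ≃ₜ Realization K)

/-- `HPol`, the full subcategory of `HTop` on the spaces of the homotopy type of a polyhedron. -/
def HPol : ObjectProperty HTop.{u} := fun X =>
  ∃ (Q : Type u) (_ : TopologicalSpace Q), IsPolyhedron Q ∧ Nonempty (X ≅ HTop.of Q)

/-- An `HPol`-expansion of a topological space. -/
abbrev HPolExpansion (X : Type u) [TopologicalSpace X] :=
  Expansion.{u} HPol.{u} (HTop.of X)

/-- `Sh*(Y, X)` for topological spaces `Y` and `X`. -/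
abbrev ShStar (Y X : Type u) [TopologicalSpace Y] [TopologicalSpace X] :=
  Hom.{u} HPol.{u} (HTop.of Y) (HTop.of X)

end CoarseShape

end

namespace CoarseShape

variable {C : Type u} [Category.{v} C] {P : ObjectProperty C} {X Y Z W : C}

/-! The argument is formal and works for any category with a full subcategory `P` in place of `HTop`
and `HPol`. Passing from morphisms to coarse shape morphisms is functorial: composition is
associative, respects composites of morphisms and identities, and does not depend on the expansions
chosen. Hence a factorization `g = f p_a` gives `g F = f (p_a F)`, so `g` cannot separate two coarse
shape morphisms that `p_a` identifies.

All three claims are instances of this, for three choices of `g`. With `g = p_b` and `b ≤ a`, the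
sets `V` shrink as the index grows, and directedness gives a basis. With `g` a projection of another
expansion, (E1) supplies the factorization, and the two topologies refine each other. With `g =
1_X`, which (E1) factors when `X` lies in `P`, each set `V_a^F` for the resulting index `a` is a
singleton. The comparison is `basic_subset_of_factors`, resting on `ofHom_comp_eq_of_mem_basic`; the
discrete case also needs `ofHom_id_comp`. -/

theorem rudimentaryHom_comp (f : X ⟶ Y) (g : Y ⟶ Z) :
    rudimentaryHom.{w} (f ≫ g) = rudimentaryHom f ≫ rudimentaryHom g := rfl

theorem rudimentaryHom_id (X : C) : rudimentaryHom.{w} (𝟙 X) = 𝟙 _ := rfl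

/-! ### Functoriality of the induced morphisms in `pro-C`. -/

namespace Expansion

/-- A morphism out of `p.toPro` into a system in `P` is determined by its composite with `p.hom`,
and both sides have the same one. -/
theorem lift_lift (p : Expansion.{w} P X) (q : Expansion.{w} P Y) (r : Expansion.{w} P Z)
    (f : X ⟶ Y) (g : Y ⟶ Z) : p.lift q f ≫ q.lift r g = p.lift r (f ≫ g) := by
  refine (p.existsUnique_lift r.toPro r.mem (rudimentaryHom (f ≫ g) ≫ r.hom)).unique ?_
    (hom_lift _ _ _)
  rw [← Category.assoc, hom_lift, Category.assoc, hom_lift, rudimentaryHom_comp, Category.assoc]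

theorem lift_id (p : Expansion.{w} P X) : p.lift p (𝟙 X) = 𝟙 _ := by
  refine (p.existsUnique_lift p.toPro p.mem (rudimentaryHom (𝟙 X) ≫ p.hom)).unique
    (hom_lift _ _ _) ?_
  rw [rudimentaryHom_id, Category.id_comp, Category.comp_id]

end Expansion

/-! ### Category laws for coarse shape morphisms. -/

namespace Hom

/-- Either bracketing inserts the same canonical isomorphisms at the two middle objects, so the
representatives are already equal by associativity in `pro*-C`, with no need to pass to common
expansions. -/
theorem comp_assoc (H : Hom.{w} P Z W) (G : Hom.{w} P Y Z) (F : Hom.{w} P X Y) :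
    (H.comp G).comp F = H.comp (G.comp F) := by
  obtain ⟨h⟩ := H
  obtain ⟨g⟩ := G
  obtain ⟨f⟩ := F
  refine congrArg (Quotient.mk _) ?_
  change (⟨_, _, _⟩ : Rep.{w} P X W) = ⟨_, _, _⟩
  simp only [Category.assoc]

theorem ofHom_comp_ofHom (p : Expansion.{w} P X) (q q' : Expansion.{w} P Y)
    (r : Expansion.{w} P Z) (f : X ⟶ Y) (g : Y ⟶ Z) :
    (ofHom q' r g).comp (ofHom p q f) = ofHom p r (f ≫ g) := by
  -- With the same expansion of `Y` on both sides, the canonical isomorphism inserted by the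
  -- composition is an identity.
  rw [ofHom_eq q' q r r g]
  refine congrArg (Quotient.mk _) ?_
  change (⟨p, r, _⟩ : Rep.{w} P X Z) = ⟨p, r, _⟩
  congr 1
  change (inclusion C).map (p.lift q f) ≫ q.canStar q ≫ (inclusion C).map (q.lift r g) = _
  rw [Expansion.canStar_self, Category.id_comp, ← Functor.map_comp, Expansion.lift_lift]

theorem ofHom_id_comp (p p' : Expansion.{w} P X) (F : Hom.{w} P Y X) :
    (ofHom p p' (𝟙 X)).comp F = F := by
  obtain ⟨f⟩ := F
  -- The identity is computed in the expansion of `X` that the representative of `F` ends in, so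
  -- that composing returns that very representative.
  rw [ofHom_eq p f.cod p' f.cod]
  refine congrArg (Quotient.mk _) ?_
  obtain ⟨d, c, f⟩ := f
  change (⟨d, c, f ≫ c.canStar c ≫ (inclusion C).map (c.lift c (𝟙 X))⟩ : Rep.{w} P Y X) =
    ⟨d, c, f⟩
  rw [Expansion.canStar_self, Expansion.lift_id, Category.id_comp, CategoryTheory.Functor.map_id]
  congr 1
  exact Category.comp_id f

end Hom

/-! ### The sets `V_a^F` and their topology. -/

namespace Expansion

theorem mem_basic_self (p : Expansion.{w} P X) (a : p.sys.Idx) (F : Hom.{w} P Y X) :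
    F ∈ p.basic Y a F := rfl

/-- If a morphism `g` factors through `p_a`, then `g ∘ F = g ∘ G` whenever `p_a ∘ F = p_a ∘ G`. -/
theorem ofHom_comp_eq_of_mem_basic (p : Expansion.{w} P X) {a : p.sys.Idx}
    (f : p.sys.obj a ⟶ Z) (q : Expansion.{w} P X) (r : Expansion.{w} P Z)
    {F G : Hom.{w} P Y X} (h : G ∈ p.basic Y a F) :
    (Hom.ofHom q r (p.proj a ≫ f)).comp F = (Hom.ofHom q r (p.proj a ≫ f)).comp G := by
  have h : (p.projStar a).comp F = (p.projStar a).comp G := h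
  -- Splitting along the rudimentary expansion of `X_a` makes the inner factor literally `p.projStar
  -- a`, to which `h` applies.
  rw [Hom.ofHom_eq q p r r,
    ← Hom.ofHom_comp_ofHom p (rudimentary (p.mem a)) (rudimentary (p.mem a)) r (p.proj a) f]
  change ((Hom.ofHom _ r f).comp (p.projStar a)).comp F =
    ((Hom.ofHom _ r f).comp (p.projStar a)).comp G
  rw [Hom.comp_assoc, h, Hom.comp_assoc]

/-- Agreement after `p_a` forces agreement after `p'_b`, because `p'_b` factors through `p_a`.
Recentring from `F` to any `G` in the larger set is harmless, since these sets are classes of an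
equivalence relation. -/
theorem basic_subset_of_factors (p p' : Expansion.{w} P X) {a : p.sys.Idx} {b : p'.sys.Idx}
    (f : p.sys.obj a ⟶ p'.sys.obj b) (hf : p.proj a ≫ f = p'.proj b)
    {F G : Hom.{w} P Y X} (hG : G ∈ p'.basic Y b F) : p.basic Y a G ⊆ p'.basic Y b F := by
  intro H hH
  have h := p.ofHom_comp_eq_of_mem_basic f p' (rudimentary (p'.mem b)) hH
  rw [hf] at h
  have hG : (p'.projStar b).comp F = (p'.projStar b).comp G := hG
  exact hG.trans h

theorem basic_subset_of_le (p : Expansion.{w} P X) {a b : p.sys.Idx} (hab : a ≤ b)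
    {F G : Hom.{w} P Y X} (hG : G ∈ p.basic Y a F) : p.basic Y b G ⊆ p.basic Y a F :=
  p.basic_subset_of_factors p (p.sys.map hab) (p.proj_map hab) hG

theorem isTopologicalBasis_basicFamily (p : Expansion.{w} P X) (Y : C) :
    @TopologicalSpace.IsTopologicalBasis _ (p.topology Y) (p.basicFamily Y) := by
  let _ := p.topology Y
  refine ⟨?_, ?_, rfl⟩
  · rintro _ ⟨F, a, rfl⟩ _ ⟨G, b, rfl⟩ H ⟨hF, hG⟩
    obtain ⟨c, hac, hbc⟩ := exists_ge_ge a b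
    exact ⟨_, ⟨H, c, rfl⟩, p.mem_basic_self c H,
      Set.subset_inter (p.basic_subset_of_le hac hF) (p.basic_subset_of_le hbc hG)⟩
  -- Covering needs at least one index, which is where nonemptiness of the directed set enters.
  · obtain ⟨a⟩ := p.sys.nonempty
    exact Set.eq_univ_of_forall fun F => ⟨_, ⟨F, a, rfl⟩, p.mem_basic_self a F⟩

theorem topology_le (p p' : Expansion.{w} P X) (Y : C) : p.topology Y ≤ p'.topology Y := by
  refine le_generateFrom ?_
  rintro _ ⟨F, b, rfl⟩
  -- (E1) applies because the terms of `p'` lie in `P`. The index `a` depends only on `b`, not on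
  -- the point `G`.
  obtain ⟨a, f, hf⟩ := p.e1 (p'.mem b) (p'.proj b)
  let _ := p.topology Y
  rw [(p.isTopologicalBasis_basicFamily Y).isOpen_iff]
  exact fun G hG => ⟨_, ⟨G, a, rfl⟩, p.mem_basic_self a G, p.basic_subset_of_factors p' f hf hG⟩

theorem topology_eq (p p' : Expansion.{w} P X) (Y : C) : p.topology Y = p'.topology Y :=
  le_antisymm (p.topology_le p' Y) (p'.topology_le p Y)

theorem discreteTopology (p : Expansion.{w} P X) (hX : P X) (Y : C) :
    @DiscreteTopology _ (p.topology Y) := by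
  let _ := p.topology Y
  -- Here `f` is a left inverse of `p_a`, so `p_a F` determines `F`; one index `a` isolates every
  -- point.
  obtain ⟨a, f, hf⟩ := p.e1 hX (𝟙 X)
  refine discreteTopology_iff_isOpen_singleton.2 fun F => ?_
  have hs : p.basic Y a F = {F} := by
    refine Set.Subset.antisymm (fun G hG => ?_) (Set.singleton_subset_iff.2 (p.mem_basic_self a F))
    have h := p.ofHom_comp_eq_of_mem_basic f p p hG
    rw [hf, Hom.ofHom_id_comp, Hom.ofHom_id_comp] at h
    exact h.symm
  rw [← hs]
  exact (p.isTopologicalBasis_basicFamily Y).isOpen ⟨F, a, rfl⟩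

end Expansion

end CoarseShape

theorem proposition3p1 (X Y : Type u) [TopologicalSpace X] [TopologicalSpace Y] :
    (∀ p : CoarseShape.HPolExpansion X,
      @TopologicalSpace.IsTopologicalBasis (CoarseShape.ShStar Y X)
        (p.topology (CoarseShape.HTop.of Y))
        {V | ∃ (F : CoarseShape.ShStar Y X) (a : p.sys.Idx),
          V = {G : CoarseShape.ShStar Y X | (p.projStar a).comp F = (p.projStar a).comp G}}) ∧
    (∀ p p' : CoarseShape.HPolExpansion X,
      @IsHomeomorph (CoarseShape.ShStar Y X) (CoarseShape.ShStar Y X)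
        (p.topology (CoarseShape.HTop.of Y)) (p'.topology (CoarseShape.HTop.of Y)) id) ∧
    (CoarseShape.HPol (CoarseShape.HTop.of X) → ∀ p : CoarseShape.HPolExpansion X,
      @DiscreteTopology (CoarseShape.ShStar Y X) (p.topology (CoarseShape.HTop.of Y))) := by
  refine ⟨fun p => p.isTopologicalBasis_basicFamily _, fun p p' => ?_,
    fun hX p => p.discreteTopology hX _⟩
  -- Once the two topologies coincide, the map is the identity of a single space.
  rw [p.topology_eq p']
  exact @IsHomeomorph.id _ (p'.topology _)
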